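/- Monoids are commutative, cancellative and have a unit element; $\mathbb N=\{1,2,3,\dots\}$ and $\mathbb N_0=\mathbb N\cup\{0\}$. For a monoid $H$ with unit group $H^\times$ and $a\in H\setminus H^\times$, let $\mathsf L(a)$ be the set of all $k\in\mathbb N$ such that $a$ is a product of $k$ atoms (irreducible elements) of $H$; put $\mathsf L(a)=\{0\}$ for $a\in H^\times$, and let $\mathcal L(H)=\{\mathsf L(a)\mid a\in H\}$. $H$ is half-factorial if $|L|=1$ for all $L\in\mathcal L(H)$, and atomic if every non-unit is a finite product of atoms. $H$ is strongly primary if $\mathfrak m=H\setminus H^\times\neq\emptyset$ and for every $a\in\mathfrak m$ there is $n\in\mathbb N$ with $\mathfrak m^n\subset aH$. $H$ is locally tame if for every atom $u$ of $H_{\mathrm{red}}=H/H^\times$ there is $N\in\mathbb N_0$ such that, for every $a\in H$ having a factorization which contains $u$ and every factorization $z$ of $a$, there is a factorization $z'$ of $a$ which contains $u$ and satisfies $\mathsf d(z,z')\le N$. Here factorizations of $a$ are the elements $z$ of the free abelian monoid on the atoms of $H_{\mathrm{red}}$ with product $aH^\times$, and $\mathsf d(z,z')=\max\{|z\gcd(z,z')^{-1}|,\,|z'\gcd(z,z')^{-1}|\}$.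 For a subset $G_0$ of an additive abelian group, $\mathcal B(G_0)$ is the monoid of zero-sum sequences over $G_0$ (finite multisets of elements of $G_0$ with sum $0$), and $\mathcal L(G_0)=\mathcal L(\mathcal B(G_0))$. A homomorphism $\theta\colon H\to B$ to an atomic monoid $B$ is a weak transfer homomorphism if $B=B^\times\theta(H)B^\times$, $\theta^{-1}(B^\times)=H^\times$, and whenever $\theta(a)=v_1\cdots v_n$ with $a\in H$, $n\in\mathbb N$ and atoms $v_i$ of $B$, there are atoms $u_1,\dots,u_n$ of $H$ and a permutation $\tau$ of $\{1,\dots,n\}$ with $a=u_1\cdots u_n$ and $\theta(u_i)\in B^\times v_{\tau(i)}B^\times$ for all $i$. $H$ is transfer Krull if there is a weak transfer homomorphism $H\to\mathcal B(G_0)$ for some subset $G_0$ of some abelian group. A set $L\subset\mathbb Z$ is an AAMP with difference $d\in\mathbb N$, period $\mathcal D$ (where $\{0,d\}\subset\mathcal D\subset[0,d]$) and bound $M\in\mathbb N_0$ if $L=y+(L'\cup L^*\cup L'')\subset y+\mathcal D+d\mathbb Z$ for some $y\in\mathbb Z$, where $L^*$ is finite and nonempty, $\min L^*=0$, $L^*=(\mathcal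 D+d\mathbb Z)\cap[0,\max L^*]$, $L'\subset[-M,-1]$ and $L''\subset\max L^*+[1,M]$. A monoid $H$ satisfies the Structure Theorem for Sets of Lengths if it is atomic and there are $M\in\mathbb N_0$ and a finite nonempty set $\Delta\subset\mathbb N$ such that every $L\in\mathcal L(H)$ is an AAMP with some difference $d\in\Delta$ (and some period) and bound $M$. **Theorem 5.6.** Let $n\ge 1$ and let $D=D_1\times\dots\times D_n$ be the direct product of strongly primary monoids $D_1,\dots,D_n$, none of which is half-factorial. 1. For every finite nonempty set $L\subset\mathbb N$ there is $y_L\in\mathbb N_0$ such that $y+L\notin\mathcal L(D)$ for every integer $y\ge y_L$. 2. $\mathcal L(D)\ne\mathcal L(G_0)$ for every subset $G_0$ of every abelian group, and $D$ is not a transfer Krull monoid. If $D_1,\dots,D_n$ are locally tame, then $D$ satisfies the Structure Theorem for Sets of Lengths. -/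

import Mathlib

open scoped Pointwise

universe u v

namespace FactorizationTheory

/-! Monoids are multiplicatively written.  Throughout, the notions below are applied to cancellative
monoids; the atoms of a monoid are its elements satisfying Mathlib's `Irreducible`. -/

section Lengths

variable (H : Type u) [Monoid H]

/-- Every non-unit is a product of finitely many atoms. -/
def IsAtomicMonoid : Prop :=
  ∀ a : H, ¬ IsUnit a → ∃ l : List H, (∀ p ∈ l, Irreducible p) ∧ l.prod = a

variable {H} in
/-- The set of lengths `L(a)`: it is `{0}` for a unit, and otherwise the set of all `k` such that
`a` is a product of `k` atoms. -/
def setOfLengths (a : H) : Set ℕ :=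
  {k | (IsUnit a ∧ k = 0) ∨
    (¬ IsUnit a ∧ ∃ l : List H, (∀ p ∈ l, Irreducible p) ∧ l.prod = a ∧ l.length = k)}

/-- The system of sets of lengths `𝓛(H) = {L(a) | a ∈ H}`. -/
def systemOfLengths : Set (Set ℕ) :=
  Set.range (fun a : H => setOfLengths a)

/-- `H` is half-factorial: every `L ∈ 𝓛(H)` has exactly one element. -/
def IsHalfFactorial : Prop :=
  ∀ L ∈ systemOfLengths H, ∃ k : ℕ, L = {k}

end Lengths

/-- `H` is strongly primary: `𝔪 = H \ Hˣ` is nonempty, and for every `a ∈ 𝔪` there is a positive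
integer `n` with `𝔪 ^ n ⊆ a H` (`𝔪 ^ n` is the set of all products of `n` elements of `𝔪`). -/
def IsStronglyPrimary (H : Type u) [CommMonoid H] : Prop :=
  (nonunits H).Nonempty ∧
    ∀ a ∈ nonunits H, ∃ n : ℕ, 0 < n ∧ nonunits H ^ n ⊆ {x : H | a ∣ x}

section Tame

variable {H : Type u} [CommMonoid H]

/-- The set `Z(a)` of factorizations of `a`, a subset of the free abelian monoid on the atoms of
the reduced monoid `H_red = H / Hˣ`. -/
def factorizations (a : H) : Set (Multiset (Associates H)) :=
  {z | (∀ p ∈ z, Irreducible p) ∧ z.prod = Associates.mk a}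

open Classical in
/-- The distance `d(z, z') = max {|z / gcd(z, z')|, |z' / gcd(z, z')|}` of two factorizations. -/
noncomputable def factorizationDist (z z' : Multiset (Associates H)) : ℕ :=
  max (z - z').card (z' - z).card

variable (H) in
/-- `H` is locally tame: for every atom `u` of `H_red` the tame degree `t(H, u)` is finite, that is,
there is `N` such that, whenever `a` has a factorization containing `u`, every factorization of `a`
has distance at most `N` from some factorization of `a` containing `u`. -/
def IsLocallyTame : Prop :=
  ∀ u : Associates H, Irreducible u → ∃ N : ℕ, ∀ a : H,
    (∃ x ∈ factorizations a, u ∈ x) →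
      ∀ z ∈ factorizations a, ∃ z' ∈ factorizations a, u ∈ z' ∧ factorizationDist z z' ≤ N

end Tame

/-- `L` is an almost arithmetical multiprogression with difference `d`, period `P` and
bound `M`. -/
def IsAAMP (L : Set ℤ) (d : ℕ) (P : Set ℤ) (M : ℕ) : Prop :=
  0 < d ∧ {0, (d : ℤ)} ⊆ P ∧ P ⊆ Set.Icc 0 (d : ℤ) ∧
    ∃ (y m : ℤ) (L₁ Lc L₂ : Set ℤ),
      L = (fun x => y + x) '' (L₁ ∪ Lc ∪ L₂) ∧
      L₁ ∪ Lc ∪ L₂ ⊆ {x | ∃ p ∈ P, ∃ k : ℤ, x = p + d * k} ∧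
      Lc.Finite ∧ IsLeast Lc 0 ∧ IsGreatest Lc m ∧
      Lc = {x | ∃ p ∈ P, ∃ k : ℤ, x = p + d * k} ∩ Set.Icc 0 m ∧
      L₁ ⊆ Set.Icc (-(M : ℤ)) (-1) ∧ L₂ ⊆ Set.Icc (m + 1) (m + M)

/-- The Structure Theorem for Sets of Lengths holds for `H`: `H` is atomic, and there are a bound
`M` and a finite nonempty set `Δ` of positive integers such that every `L ∈ 𝓛(H)` is an AAMP with
bound `M` and some difference `d ∈ Δ`. -/
def SatisfiesStructureTheorem (H : Type u) [Monoid H] : Prop :=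
  IsAtomicMonoid H ∧ ∃ (M : ℕ) (Δ : Finset ℕ), Δ.Nonempty ∧ (∀ d ∈ Δ, 0 < d) ∧
    ∀ L ∈ systemOfLengths H, ∃ d ∈ Δ, ∃ P : Set ℤ, IsAAMP ((fun k : ℕ => (k : ℤ)) '' L) d P M

/-- The monoid `𝓑(G₀)` of zero-sum sequences over a subset `G₀` of an additive abelian group `G`,
inside the (multiplicatively written) free abelian monoid of all finite multisets over `G`. -/
def zeroSumMonoid {G : Type v} [AddCommGroup G] (G₀ : Set G) :
    Submonoid (Multiplicative (Multiset G)) where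
  carrier := {S | (∀ g ∈ S.toAdd, g ∈ G₀) ∧ S.toAdd.sum = 0}
  one_mem' := by simp
  mul_mem' := by
    rintro S T ⟨hS, hS0⟩ ⟨hT, hT0⟩
    refine ⟨fun g hg => ?_, ?_⟩
    · rw [toAdd_mul, Multiset.mem_add] at hg
      exact hg.elim (hS g) (hT g)
    · rw [toAdd_mul, Multiset.sum_add, hS0, hT0, add_zero]

/-- `θ : H → B` is a weak transfer homomorphism: `B` is atomic, `B = Bˣ θ(H) Bˣ`,
`θ⁻¹(Bˣ) = Hˣ`, and every factorization `θ(a) = v₁ ⋯ vₙ` into atoms (`n ≥ 1`) lifts, up to order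
and units, to a factorization `a = u₁ ⋯ uₙ` into atoms. -/
def IsWeakTransferHom {H : Type u} {B : Type v} [Monoid H] [Monoid B] (θ : H →* B) : Prop :=
  IsAtomicMonoid B ∧
  (∀ b : B, ∃ (e f : Bˣ) (a : H), b = e * θ a * f) ∧
  (∀ a : H, IsUnit (θ a) ↔ IsUnit a) ∧
  ∀ (a : H) (n : ℕ) (v : Fin n → B), 0 < n → (∀ i, Irreducible (v i)) →
    θ a = (List.ofFn v).prod →
      ∃ (w : Fin n → H) (τ : Equiv.Perm (Fin n)), (∀ i, Irreducible (w i)) ∧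
        a = (List.ofFn w).prod ∧ ∀ i, ∃ e f : Bˣ, θ (w i) = e * v (τ i) * f

/-- `H` is a transfer Krull monoid: it has a weak transfer homomorphism to `𝓑(G₀)` for some subset
`G₀` of some abelian group `G` (in the universe `v`). -/
def IsTransferKrull (H : Type u) [Monoid H] : Prop :=
  ∃ (G : Type v) (_ : AddCommGroup G) (G₀ : Set G) (θ : H →* zeroSumMonoid G₀),
    IsWeakTransferHom θ

end FactorizationTheory

open FactorizationTheory

/-! In a strongly primary monoid a fixed element divides every sufficiently long product of atoms.
If some `c` has two distinct lengths, then `c ^ r` has two lengths at least `r` apart, and so does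
each of its multiples. Hence long factorizations force sets of lengths of large diameter
(`exists_add_le_of_not_isHalfFactorial`). In a direct product, sets of lengths are sumsets of those
of the components (`mem_setOfLengths_pi_iff`), and a large length forces a large length in some
component. So a far translate of a fixed finite set, whose diameter stays fixed, cannot occur.

In contrast, a nontrivial `𝓑(G₀)` has an atom whose powers factor uniquely, so every singleton `{k}`
is a set of lengths. Weak transfer homomorphisms preserve systems of lengths, which also excludes
transfer Krull monoids.

For the Structure Theorem, local tameness bounds the gaps in sets of lengths, and splitting off a
fixed power `c ^ C` fills these gaps with an arithmetical progression of difference `d`, the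
generator of the group of all length differences. Each component therefore has almost periodic sets
of lengths (`exists_isAlmostPeriodic`). Almost periodicity survives sumsets (`IsAlmostPeriodic.add`)
and yields AAMPs (`exists_isAAMP`). -/

namespace FactorizationTheory


/-! ### Sets of lengths and divisibility in strongly primary monoids. -/

section CommMonoid

variable {H : Type u} [CommMonoid H]

theorem exists_add_eq_card_eq {α : Type*} {s : Multiset α} {n : ℕ} (h : n ≤ s.card) :
    ∃ t r : Multiset α, s = t + r ∧ t.card = n := by
  induction s using Quotient.inductionOn with
  | h l =>
    refine ⟨(l.take n : List α), (l.drop n : List α), ?_, by simpa using h⟩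
    simp

/-- Sets of lengths in terms of multisets of atoms, up to associates. -/
theorem mem_setOfLengths_iff {a : H} {k : ℕ} :
    k ∈ setOfLengths a ↔
      ∃ s : Multiset H, (∀ p ∈ s, Irreducible p) ∧ Associated s.prod a ∧ s.card = k := by
  constructor
  · rintro (⟨ha, rfl⟩ | ⟨_, l, hl, rfl, rfl⟩)
    · exact ⟨0, by simp, by simpa [associated_one_iff_isUnit] using
        (associated_one_iff_isUnit.2 ha).symm, by simp⟩
    · exact ⟨l, by simpa using hl, by simp, by simp⟩
  · rintro ⟨s, hs, ⟨e, he⟩, rfl⟩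
    induction s using Multiset.induction with
    | empty => exact Or.inl ⟨by rw [← he]; simp, rfl⟩
    | cons p s _ =>
      have hp := hs p (Multiset.mem_cons_self _ _)
      refine Or.inr ⟨fun ha => hp.not_isUnit ?_, (p * e) :: s.toList, ?_, ?_, by simp⟩
      · rw [← he, Multiset.prod_cons, mul_assoc] at ha
        exact isUnit_of_mul_isUnit_left ha
      · intro q hq
        rcases List.mem_cons.1 hq with rfl | hq
        · exact (irreducible_mul_units e).2 hp
        · exact hs q (Multiset.mem_cons_of_mem (Multiset.mem_toList.1 hq))
      · rw [List.prod_cons, Multiset.prod_toList, ← he, Multiset.prod_cons, mul_right_comm]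

theorem setOfLengths_congr {a b : H} (h : Associated a b) : setOfLengths a = setOfLengths b := by
  ext k
  simp only [mem_setOfLengths_iff]
  exact ⟨fun ⟨s, h1, h2, h3⟩ => ⟨s, h1, h2.trans h, h3⟩,
    fun ⟨s, h1, h2, h3⟩ => ⟨s, h1, h2.trans h.symm, h3⟩⟩

theorem add_mem_setOfLengths {a b : H} {k l : ℕ} (hk : k ∈ setOfLengths a)
    (hl : l ∈ setOfLengths b) : k + l ∈ setOfLengths (a * b) := by
  rw [mem_setOfLengths_iff] at *
  obtain ⟨s, hs, hsa, rfl⟩ := hk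
  obtain ⟨t, ht, htb, rfl⟩ := hl
  refine ⟨s + t, fun p hp => (Multiset.mem_add.1 hp).elim (hs p) (ht p), ?_, by simp⟩
  rw [Multiset.prod_add]
  exact hsa.mul_mul htb

theorem setOfLengths_of_isUnit {a : H} (ha : IsUnit a) : setOfLengths a = {0} := by
  ext k
  simp [setOfLengths, ha]

theorem zero_mem_setOfLengths_iff {a : H} : 0 ∈ setOfLengths a ↔ IsUnit a := by
  constructor
  · intro h
    obtain ⟨s, -, hs, h0⟩ := mem_setOfLengths_iff.1 h
    rw [Multiset.card_eq_zero.1 h0, Multiset.prod_zero] at hs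
    exact associated_one_iff_isUnit.1 hs.symm
  · intro h
    simp [setOfLengths_of_isUnit h]

theorem one_mem_setOfLengths {a : H} (ha : Irreducible a) : 1 ∈ setOfLengths a :=
  mem_setOfLengths_iff.2 ⟨{a}, by simpa using ha, by simp, by simp⟩

theorem mul_mem_setOfLengths_pow {a : H} {k : ℕ} (hk : k ∈ setOfLengths a) (n : ℕ) :
    n * k ∈ setOfLengths (a ^ n) := by
  induction n with
  | zero => simp [setOfLengths_of_isUnit]
  | succ n ih =>
    rw [pow_succ, add_mul, one_mul]
    exact add_mem_setOfLengths ih hk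

theorem isAtomicMonoid_iff_setOfLengths_nonempty :
    IsAtomicMonoid H ↔ ∀ a : H, (setOfLengths a).Nonempty := by
  constructor
  · intro h a
    by_cases ha : IsUnit a
    · exact ⟨0, zero_mem_setOfLengths_iff.2 ha⟩
    · obtain ⟨l, hl, hla⟩ := h a ha
      exact ⟨l.length, Or.inr ⟨ha, l, hl, hla, rfl⟩⟩
  · intro h a ha
    obtain ⟨k, ⟨ha', -⟩ | ⟨-, l, hl, hla, -⟩⟩ := h a
    · exact absurd ha' ha
    · exact ⟨l, hl, hla⟩

theorem prod_mem_nonunits_pow {s : Multiset H} {n : ℕ} (hs : ∀ p ∈ s, ¬ IsUnit p)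
    (hn : s.card = n) : s.prod ∈ nonunits H ^ n := by
  subst hn
  induction s using Multiset.induction with
  | empty => simp
  | cons p s ih =>
    rw [Multiset.card_cons, Multiset.prod_cons, pow_succ, mul_comm p]
    exact Set.mul_mem_mul (ih fun q hq => hs q (Multiset.mem_cons_of_mem hq))
      (hs p (Multiset.mem_cons_self _ _))

/-- In a strongly primary monoid, every sufficiently long product of non-units is divisible by a
given element. -/
theorem IsStronglyPrimary.exists_dvd_of_card_le (h : IsStronglyPrimary H) (a : H) :
    ∃ n : ℕ, ∀ s : Multiset H, (∀ p ∈ s, ¬ IsUnit p) → n ≤ s.card → a ∣ s.prod := by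
  by_cases ha : IsUnit a
  · exact ⟨0, fun s _ _ => ha.dvd⟩
  · obtain ⟨n, -, hn⟩ := h.2 a ha
    refine ⟨n, fun s hs hc => ?_⟩
    obtain ⟨t, r, rfl, ht⟩ := exists_add_eq_card_eq hc
    rw [Multiset.prod_add]
    exact Dvd.dvd.mul_right (hn (prod_mem_nonunits_pow (fun p hp =>
      hs p (Multiset.mem_add.2 (Or.inl hp))) ht)) _

theorem IsStronglyPrimary.exists_dvd_of_mem_setOfLengths (h : IsStronglyPrimary H) (e : H) :
    ∃ n : ℕ, ∀ a : H, ∀ k ∈ setOfLengths a, n ≤ k → e ∣ a := by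
  obtain ⟨n, hn⟩ := h.exists_dvd_of_card_le e
  refine ⟨n, fun a k hk hnk => ?_⟩
  obtain ⟨s, hs, hsa, rfl⟩ := mem_setOfLengths_iff.1 hk
  exact (hn s (fun p hp => (hs p hp).not_isUnit) hnk).trans hsa.dvd

/-- If `a = x * y` with non-units, adding `y` to a product of non-units equal to `x` gives a longer
one equal to `a`, so the bound drops by one for each factor. -/
theorem setOfLengths_nonempty_of_bounded (n : ℕ) : ∀ a : H, ¬ IsUnit a →
    (∀ s : Multiset H, (∀ p ∈ s, ¬ IsUnit p) → s.prod = a → s.card ≤ n) →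
      (setOfLengths a).Nonempty := by
  induction n with
  | zero =>
    intro a ha h
    simpa using h {a} (by simpa using ha) (by simp)
  | succ n ih =>
    intro a ha h
    by_cases hirr : Irreducible a
    · exact ⟨1, one_mem_setOfLengths hirr⟩
    · simp only [irreducible_iff, ha, not_false_eq_true, true_and, not_forall, not_or] at hirr
      obtain ⟨x, y, hxy, hx, hy⟩ := hirr
      have aux : ∀ x y : H, a = x * y → ¬ IsUnit x → ¬ IsUnit y →
          (setOfLengths x).Nonempty := by
        intro x y hxy hx hy
        refine ih x hx fun s hs hsx => ?_
        have := h (y ::ₘ s) ?_ ?_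
        · simpa using this
        · intro p hp
          rcases Multiset.mem_cons.1 hp with rfl | hp
          exacts [hy, hs p hp]
        · rw [Multiset.prod_cons, hsx, hxy, mul_comm]
      obtain ⟨k, hk⟩ := aux x y hxy hx hy
      obtain ⟨l, hl⟩ := aux y x (by rw [hxy, mul_comm]) hy hx
      exact ⟨k + l, hxy ▸ add_mem_setOfLengths hk hl⟩

end CommMonoid

/-! ### Consequences of cancellation: finite sets of lengths, and large diameters. -/

section CancelCommMonoid

variable {H : Type u} [CancelCommMonoid H]

/-- Some `n` makes `a` divide every product of `n` non-units. With more than `n` factors, `a` would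
divide a proper subproduct of itself, and cancelling makes the remaining non-units units. -/
theorem IsStronglyPrimary.exists_card_le (h : IsStronglyPrimary H) (a : H) :
    ∃ n : ℕ, ∀ s : Multiset H, (∀ p ∈ s, ¬ IsUnit p) → Associated s.prod a → s.card ≤ n := by
  obtain ⟨n, hn⟩ := h.exists_dvd_of_card_le a
  refine ⟨n, fun s hs hsa => ?_⟩
  by_contra! hlt
  obtain ⟨t, r, rfl, ht⟩ := exists_add_eq_card_eq hlt.le
  obtain ⟨b, hb⟩ := hsa.dvd.trans (hn t (fun p hp => hs p (Multiset.mem_add.2 (Or.inl hp))) ht.ge)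
  rw [Multiset.prod_add, mul_assoc, left_eq_mul] at hb
  have hr : r ≠ 0 := by
    rintro rfl
    simp at hlt
    omega
  obtain ⟨p, hp⟩ := Multiset.exists_mem_of_ne_zero hr
  exact hs p (Multiset.mem_add.2 (Or.inr hp))
    (isUnit_of_dvd_unit (Multiset.dvd_prod hp) (IsUnit.of_mul_eq_one b hb))

theorem IsStronglyPrimary.exists_setOfLengths_le (h : IsStronglyPrimary H) (a : H) :
    ∃ n : ℕ, ∀ k ∈ setOfLengths a, k ≤ n := by
  obtain ⟨n, hn⟩ := h.exists_card_le a
  refine ⟨n, fun k hk => ?_⟩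
  obtain ⟨s, hs, hsa, rfl⟩ := mem_setOfLengths_iff.1 hk
  exact hn s (fun p hp => (hs p hp).not_isUnit) hsa

theorem IsStronglyPrimary.setOfLengths_nonempty (h : IsStronglyPrimary H) (a : H) :
    (setOfLengths a).Nonempty := by
  by_cases ha : IsUnit a
  · exact ⟨0, zero_mem_setOfLengths_iff.2 ha⟩
  · obtain ⟨n, hn⟩ := h.exists_card_le a
    exact setOfLengths_nonempty_of_bounded n a ha fun s hs hsa => hn s hs (hsa ▸ Associated.refl _)

theorem IsStronglyPrimary.exists_lt_of_not_isHalfFactorial (h : IsStronglyPrimary H)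
    (hn : ¬ IsHalfFactorial H) :
    ∃ c : H, ∃ k ∈ setOfLengths c, ∃ l ∈ setOfLengths c, k < l := by
  by_contra! hc
  refine hn ?_
  rintro _ ⟨a, rfl⟩
  obtain ⟨k, hk⟩ := h.setOfLengths_nonempty a
  exact ⟨k, Set.eq_singleton_iff_unique_mem.2
    ⟨hk, fun l hl => le_antisymm (hc a k hk l hl) (hc a l hl k hk)⟩⟩

theorem IsStronglyPrimary.exists_add_le_of_not_isHalfFactorial (h : IsStronglyPrimary H)
    (hn : ¬ IsHalfFactorial H) (r : ℕ) :
    ∃ n : ℕ, ∀ a : H, ∀ x ∈ setOfLengths a, n ≤ x →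
      ∃ k ∈ setOfLengths a, ∃ l ∈ setOfLengths a, k + r ≤ l := by
  obtain ⟨c, k, hk, l, hl, hkl⟩ := h.exists_lt_of_not_isHalfFactorial hn
  obtain ⟨n, hdvd⟩ := h.exists_dvd_of_mem_setOfLengths (c ^ r)
  refine ⟨n, fun a x hx hnx => ?_⟩
  obtain ⟨b, rfl⟩ := hdvd a x hx hnx
  obtain ⟨y, hy⟩ := h.setOfLengths_nonempty b
  refine ⟨_, add_mem_setOfLengths (mul_mem_setOfLengths_pow hk r) hy,
    _, add_mem_setOfLengths (mul_mem_setOfLengths_pow hl r) hy, ?_⟩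
  nlinarith

end CancelCommMonoid

/-! ### Atoms and lengths in direct products. -/

section Pi

variable {ι : Type*} [DecidableEq ι] {D : ι → Type u} [∀ i, CommMonoid (D i)]

theorem isUnit_mulSingle_iff {i : ι} {x : D i} :
    IsUnit (Pi.mulSingle i x : ∀ i, D i) ↔ IsUnit x := by
  rw [Pi.isUnit_iff]
  constructor
  · intro h
    simpa using h i
  · intro h j
    by_cases hj : j = i
    · subst hj
      simpa using h
    · simp [Pi.mulSingle_eq_of_ne hj]

theorem irreducible_mulSingle {i : ι} {x : D i} (hx : Irreducible x) :
    Irreducible (Pi.mulSingle i x : ∀ i, D i) := by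
  refine ⟨fun h => hx.not_isUnit (isUnit_mulSingle_iff.1 h), fun a b hab => ?_⟩
  have hj : ∀ j, j ≠ i → IsUnit (a j) ∧ IsUnit (b j) := by
    intro j hj
    have := congrFun hab j
    rw [Pi.mulSingle_eq_of_ne hj, Pi.mul_apply] at this
    exact ⟨IsUnit.of_mul_eq_one _ this.symm,
      IsUnit.of_mul_eq_one (a j) (by rw [mul_comm, ← this])⟩
  have hi := congrFun hab i
  rw [Pi.mulSingle_eq_same, Pi.mul_apply] at hi
  have aux : ∀ c : ∀ i, D i, IsUnit (c i) → (∀ j, j ≠ i → IsUnit (c j)) → IsUnit c := by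
    intro c hci hcj
    rw [Pi.isUnit_iff]
    intro j
    by_cases hji : j = i
    · exact hji ▸ hci
    · exact hcj j hji
  exact (hx.isUnit_or_isUnit hi).imp (fun h => aux a h fun j h' => (hj j h').1)
    (fun h => aux b h fun j h' => (hj j h').2)

theorem irreducible_pi {p : ∀ i, D i} (hp : Irreducible p) :
    ∃ i, Irreducible (p i) ∧ ∀ j, j ≠ i → IsUnit (p j) := by
  obtain ⟨i, hi⟩ : ∃ i, ¬ IsUnit (p i) := by
    have := hp.not_isUnit
    rw [Pi.isUnit_iff] at this
    exact not_forall.1 this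
  have key : ∀ x y : D i, p i = x * y → IsUnit x ∨ (IsUnit y ∧ ∀ j, j ≠ i → IsUnit (p j)) := by
    intro x y hxy
    have : p = Pi.mulSingle i x * Function.update p i y := by
      ext j
      by_cases hj : j = i
      · subst hj
        simpa using hxy
      · simp [hj]
    refine (hp.isUnit_or_isUnit this).imp isUnit_mulSingle_iff.1 fun h => ?_
    rw [Pi.isUnit_iff] at h
    exact ⟨by simpa using h i, fun j hj => by simpa [hj] using h j⟩
  refine ⟨i, ⟨hi, fun x y hxy => (key x y hxy).imp id And.left⟩, ?_⟩
  -- Splitting off the whole `i`-th coordinate leaves a cofactor that must be a unit, as `p i` is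
  -- not.
  exact ((key (p i) 1 (by simp)).resolve_left hi).2

theorem mem_setOfLengths_mulSingle {i : ι} {x : D i} {k : ℕ} (hk : k ∈ setOfLengths x) :
    k ∈ setOfLengths (Pi.mulSingle i x : ∀ i, D i) := by
  rw [mem_setOfLengths_iff] at *
  obtain ⟨s, hs, hsx, rfl⟩ := hk
  refine ⟨s.map (MonoidHom.mulSingle D i), fun p hp => ?_, ?_, by simp⟩
  · obtain ⟨q, hq, rfl⟩ := Multiset.mem_map.1 hp
    exact irreducible_mulSingle (hs q hq)
  · rw [← map_multiset_prod]
    exact hsx.map (MonoidHom.mulSingle D i)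

/-- Sets of lengths in a direct product are the sumsets of the sets of lengths of the
components. -/
theorem mem_setOfLengths_pi_iff [Fintype ι] {a : ∀ i, D i} {k : ℕ} :
    k ∈ setOfLengths a ↔ ∃ f : ι → ℕ, (∀ i, f i ∈ setOfLengths (a i)) ∧ ∑ i, f i = k := by
  constructor
  · intro hk
    obtain ⟨s, hs, hsa, rfl⟩ := mem_setOfLengths_iff.1 hk
    have hsa' : ∀ i, Associated (s.prod i) (a i) := fun i => hsa.map (Pi.evalMonoidHom D i)
    simp only [← fun i => setOfLengths_congr (hsa' i)]
    clear hsa hsa' hk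
    induction s using Multiset.induction with
    | empty => exact ⟨0, fun i => by simp [setOfLengths_of_isUnit], by simp⟩
    | cons p s ih =>
      obtain ⟨f, hf, hfs⟩ := ih fun q hq => hs q (Multiset.mem_cons_of_mem hq)
      obtain ⟨i, hi, hj⟩ := irreducible_pi (hs p (Multiset.mem_cons_self _ _))
      -- An atom of the product has length 1 in its single non-unit coordinate and length 0 in the
      -- others.
      refine ⟨Pi.single i 1 + f, fun j => ?_, ?_⟩
      · rw [Multiset.prod_cons, Pi.mul_apply, Pi.add_apply]
        refine add_mem_setOfLengths ?_ (hf j)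
        by_cases hji : j = i
        · subst hji
          simpa using one_mem_setOfLengths hi
        · simpa [hji] using zero_mem_setOfLengths_iff.2 (hj j hji)
      · simp [Finset.sum_add_distrib, hfs, add_comm]
  · rintro ⟨f, hf, rfl⟩
    rw [← Finset.univ_prod_mulSingle a]
    have : ∀ S : Finset ι, ∑ i ∈ S, f i ∈ setOfLengths (∏ i ∈ S, Pi.mulSingle i (a i)) := by
      intro S
      induction S using Finset.induction_on with
      | empty => simp [setOfLengths_of_isUnit]
      | insert i S hi ih =>
        rw [Finset.sum_insert hi, Finset.prod_insert hi]
        exact add_mem_setOfLengths (mem_setOfLengths_mulSingle (hf i)) ih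
    exact this _

end Pi


/-! ### Zero-sum sequences and weak transfer homomorphisms. -/

section ZeroSum

variable {G : Type v} [AddCommGroup G] {G₀ : Set G}

theorem isUnit_zeroSumMonoid_iff {B : zeroSumMonoid G₀} : IsUnit B ↔ B = 1 := by
  constructor
  · intro h
    obtain ⟨C, hC⟩ := h.exists_right_inv
    have h1 : (B : Multiplicative (Multiset G)).toAdd + C.1.toAdd = 0 :=
      congrArg (fun x : zeroSumMonoid G₀ => x.1.toAdd) hC
    have h2 := (add_eq_zero.1 h1).1
    exact Subtype.ext h2
  · rintro rfl
    exact isUnit_one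

/-- A nontrivial monoid of zero-sum sequences contains a nontrivial sequence that is contained in
every nontrivial zero-sum sequence supported on its support. -/
theorem exists_zeroSum_minimal (h : ∃ B : zeroSumMonoid G₀, B ≠ 1) :
    ∃ A : zeroSumMonoid G₀, A ≠ 1 ∧ ∀ B : zeroSumMonoid G₀, B ≠ 1 →
      (∀ g ∈ B.1.toAdd, g ∈ A.1.toAdd) → A.1.toAdd ≤ B.1.toAdd := by
  classical
  -- `A` minimizes first the size of the support, then the length.
  let μ : zeroSumMonoid G₀ → ℕ ×ₗ ℕ :=
    fun B => toLex (B.1.toAdd.toFinset.card, B.1.toAdd.card)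
  obtain ⟨A, hA1, hmin⟩ := (InvImage.wf μ wellFounded_lt).has_min {B | B ≠ 1} h
  have hmin' : ∀ B : zeroSumMonoid G₀, B ≠ 1 → ¬ (μ B < μ A) := hmin
  refine ⟨A, hA1, fun B hB hBA => ?_⟩
  have hsub : B.1.toAdd.toFinset ⊆ A.1.toAdd.toFinset := by
    intro g hg
    exact Multiset.mem_toFinset.2 (hBA g (Multiset.mem_toFinset.1 hg))
  have hne : A.1.toAdd ≠ 0 := fun h0 => hA1 (Subtype.ext h0)
  have hpos : ∀ g ∈ A.1.toAdd.toFinset, 0 < A.1.toAdd.count g := fun g hg =>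
    Multiset.count_pos.2 (Multiset.mem_toFinset.1 hg)
  -- With the multiplicity ratio of `B` to `A` minimal at `g`, a multiple of `A` can be subtracted
  -- from a multiple of `B` so that `g` disappears. The zero-sum remainder `C` has smaller support,
  -- so it is trivial and `A`, `B` are proportional.
  obtain ⟨g, hg, hgmin⟩ := Finset.exists_min_image A.1.toAdd.toFinset
    (fun g => (B.1.toAdd.count g : ℚ) / A.1.toAdd.count g) (by simpa using hne)
  have hle : ∀ h, A.1.toAdd.count h * B.1.toAdd.count g ≤
      A.1.toAdd.count g * B.1.toAdd.count h := by
    intro h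
    by_cases hh : h ∈ A.1.toAdd.toFinset
    · have := hgmin h hh
      rw [div_le_div_iff₀ (by exact_mod_cast hpos g hg) (by exact_mod_cast hpos h hh)] at this
      have : B.1.toAdd.count g * A.1.toAdd.count h ≤ B.1.toAdd.count h * A.1.toAdd.count g := by
        exact_mod_cast this
      linarith
    · rw [Multiset.mem_toFinset] at hh
      simp [Multiset.count_eq_zero_of_notMem hh]
  have hleM : B.1.toAdd.count g • A.1.toAdd ≤ A.1.toAdd.count g • B.1.toAdd := by
    rw [Multiset.le_iff_count]
    intro h
    rw [Multiset.count_nsmul, Multiset.count_nsmul, mul_comm]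
    exact hle h
  obtain ⟨C, hC⟩ := Multiset.le_iff_exists_add.1 hleM
  have hCmem : Multiplicative.ofAdd C ∈ zeroSumMonoid G₀ := by
    refine ⟨fun h hh => ?_, ?_⟩
    · have : h ∈ A.1.toAdd.count g • B.1.toAdd := hC ▸ Multiset.mem_add.2 (Or.inr hh)
      exact B.2.1 h (Multiset.mem_of_mem_nsmul this)
    · have := congrArg Multiset.sum hC
      rw [Multiset.sum_add, Multiset.sum_nsmul, Multiset.sum_nsmul, A.2.2, B.2.2] at this
      simpa using this.symm
  have hcount : ∀ h, A.1.toAdd.count g * B.1.toAdd.count h =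
      B.1.toAdd.count g * A.1.toAdd.count h + C.count h := by
    intro h
    have := congrArg (Multiset.count h) hC
    rwa [Multiset.count_add, Multiset.count_nsmul, Multiset.count_nsmul] at this
  have hC0 : C = 0 := by
    by_contra hC0
    refine hmin' ⟨_, hCmem⟩ (fun h => hC0 (congrArg (fun x : zeroSumMonoid G₀ => x.1.toAdd) h)) ?_
    refine Prod.Lex.toLex_lt_toLex.2 (Or.inl (Finset.card_lt_card ?_))
    refine Finset.ssubset_iff_subset_ne.2 ⟨fun h hh => ?_, fun heq => ?_⟩
    · have hh' : h ∈ C := Multiset.mem_toFinset.1 hh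
      have : h ∈ A.1.toAdd.count g • B.1.toAdd := hC ▸ Multiset.mem_add.2 (Or.inr hh')
      exact hsub (Multiset.mem_toFinset.2 (Multiset.mem_of_mem_nsmul this))
    · have hgC : g ∈ C := Multiset.mem_toFinset.1 (heq ▸ hg)
      have h1 := hcount g
      have h2 := Multiset.count_pos.2 hgC
      rw [mul_comm] at h1
      omega
  simp only [hC0, Multiset.count_zero, add_zero] at hcount
  rw [Multiset.le_iff_count]
  -- By proportionality, comparing multiplicities at `g` compares the whole sequences. A strictly
  -- smaller `B` would contradict the minimality of `A`.
  by_cases hlt : A.1.toAdd.count g ≤ B.1.toAdd.count g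
  · intro h
    refine Nat.le_of_mul_le_mul_left ?_ (hpos g hg)
    rw [hcount h]
    exact Nat.mul_le_mul_right _ hlt
  · exfalso
    push Not at hlt
    have hBA' : B.1.toAdd ≤ A.1.toAdd := by
      rw [Multiset.le_iff_count]
      intro h
      refine Nat.le_of_mul_le_mul_left ?_ (hpos g hg)
      rw [hcount h]
      exact Nat.mul_le_mul_right _ hlt.le
    have hne' : B.1.toAdd ≠ A.1.toAdd := fun heq => by
      rw [heq] at hlt
      exact lt_irrefl _ hlt
    have hcard := Multiset.card_lt_card (lt_of_le_of_ne hBA' hne')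
    refine hmin' B hB (Prod.Lex.toLex_lt_toLex.2 ?_)
    rcases (Finset.card_le_card hsub).lt_or_eq with h | h
    exacts [Or.inl h, Or.inr ⟨h, hcard⟩]

/-- Let `A` be the minimal sequence just found. Any atom dividing `A ^ k` is supported on the
support of `A`, so it contains `A` and equals it; hence `A ^ k` factors only as itself. -/
theorem singleton_mem_systemOfLengths_zeroSumMonoid (h : ∃ B : zeroSumMonoid G₀, B ≠ 1) (k : ℕ) :
    {k} ∈ systemOfLengths (zeroSumMonoid G₀) := by
  obtain ⟨A, hA1, hA⟩ := exists_zeroSum_minimal h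
  have hne : A.1.toAdd ≠ 0 := fun h0 => hA1 (Subtype.ext h0)
  have hcard : 0 < A.1.toAdd.card := Multiset.card_pos.2 hne
  have hirr : Irreducible A := by
    refine ⟨fun hu => hA1 (isUnit_zeroSumMonoid_iff.1 hu), fun B C hBC => ?_⟩
    by_contra! hcon
    rw [isUnit_zeroSumMonoid_iff, isUnit_zeroSumMonoid_iff] at hcon
    have hBC' : A.1.toAdd = B.1.toAdd + C.1.toAdd :=
      congrArg (fun x : zeroSumMonoid G₀ => x.1.toAdd) hBC
    have h1 := Multiset.card_le_card (hA B hcon.1 fun g hg => by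
      rw [hBC']; exact Multiset.mem_add.2 (Or.inl hg))
    have h2 := Multiset.card_le_card (hA C hcon.2 fun g hg => by
      rw [hBC']; exact Multiset.mem_add.2 (Or.inr hg))
    have h3 := congrArg Multiset.card hBC'
    rw [Multiset.card_add] at h3
    omega
  have hpow : ∀ n : ℕ, (A ^ n).1.toAdd = n • A.1.toAdd := fun n => rfl
  refine ⟨A ^ k, Set.eq_singleton_iff_unique_mem.2 ⟨?_, fun l hl => ?_⟩⟩
  · simpa using mul_mem_setOfLengths_pow (one_mem_setOfLengths hirr) k
  · obtain ⟨s, hs, hsA, rfl⟩ := mem_setOfLengths_iff.1 hl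
    obtain ⟨e, he⟩ := hsA
    rw [isUnit_zeroSumMonoid_iff.1 e.isUnit, mul_one] at he
    have hall : ∀ p ∈ s, p = A := by
      intro p hp
      obtain ⟨q, hq⟩ := Multiset.dvd_prod hp
      have hle : A.1.toAdd ≤ p.1.toAdd := by
        refine hA p (fun h1 => (hs p hp).not_isUnit (h1 ▸ isUnit_one)) fun g hg => ?_
        have : (A ^ k).1.toAdd = p.1.toAdd + q.1.toAdd :=
          congrArg (fun x : zeroSumMonoid G₀ => x.1.toAdd) (he.symm.trans hq)
        rw [hpow] at this
        exact Multiset.mem_of_mem_nsmul (this ▸ Multiset.mem_add.2 (Or.inl hg))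
      obtain ⟨C, hC⟩ := Multiset.le_iff_exists_add.1 hle
      have hCmem : Multiplicative.ofAdd C ∈ zeroSumMonoid G₀ := by
        refine ⟨fun g hg => p.2.1 g (hC ▸ Multiset.mem_add.2 (Or.inr hg)), ?_⟩
        have := congrArg Multiset.sum hC
        rw [Multiset.sum_add, A.2.2, p.2.2, zero_add] at this
        exact this.symm
      have hpC : p = A * ⟨_, hCmem⟩ := Subtype.ext hC
      have := ((hs p hp).isUnit_or_isUnit hpC).resolve_left hirr.not_isUnit
      rw [hpC, isUnit_zeroSumMonoid_iff.1 this, mul_one]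
    rw [Multiset.eq_replicate_card.2 hall, Multiset.prod_replicate] at he
    have h1 := congrArg (fun x : zeroSumMonoid G₀ => x.1.toAdd.card) he
    simp only [hpow, Multiset.card_nsmul] at h1
    exact Nat.eq_of_mul_eq_mul_right hcard h1

theorem systemOfLengths_eq_of_isWeakTransferHom {H : Type u} [Monoid H]
    {θ : H →* zeroSumMonoid G₀} (hθ : IsWeakTransferHom θ) :
    systemOfLengths H = systemOfLengths (zeroSumMonoid G₀) := by
  obtain ⟨hat, hsurj, hunit, hlift⟩ := hθ
  have hone : ∀ e : (zeroSumMonoid G₀)ˣ, (e : zeroSumMonoid G₀) = 1 :=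
    fun e => isUnit_zeroSumMonoid_iff.1 e.isUnit
  have hatom : ∀ x : H, Irreducible x → Irreducible (θ x) := by
    intro x hx
    have hnu : ¬ IsUnit (θ x) := fun h => hx.not_isUnit ((hunit x).1 h)
    obtain ⟨l, hl, hlx⟩ := hat (θ x) hnu
    have hl0 : 0 < l.length := by
      rw [List.length_pos_iff]
      rintro rfl
      exact hnu (by rw [← hlx]; simp)
    -- A factorization of `θ x` lifts to one of the atom `x` with equally many factors, so it has
    -- only one.
    obtain ⟨w, τ, hw, hxw, -⟩ := hlift x l.length l.get hl0 (fun i => hl _ (List.get_mem _ _))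
      (by rw [List.ofFn_get]; exact hlx.symm)
    have hlen : l.length = 1 := by
      obtain ⟨m, hm⟩ : ∃ m, l.length = m + 1 := ⟨l.length - 1, by omega⟩
      generalize l.length = n at *
      subst hm
      rw [List.ofFn_succ, List.prod_cons] at hxw
      have hu := (hx.isUnit_or_isUnit hxw).resolve_left (hw 0).not_isUnit
      by_contra hm1
      obtain ⟨m, rfl⟩ : ∃ r, m = r + 1 := ⟨m - 1, by omega⟩
      have hθu := (hunit _).2 hu
      rw [List.ofFn_succ, List.prod_cons, map_mul] at hθu
      exact (hw (Fin.succ 0)).not_isUnit ((hunit _).1 (isUnit_of_mul_isUnit_left hθu))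
    obtain ⟨p, rfl⟩ := List.length_eq_one_iff.1 hlen
    rw [← hlx]
    simpa using hl
  have hL : ∀ a : H, setOfLengths a = setOfLengths (θ a) := by
    intro a
    ext k
    constructor
    · rintro (⟨ha, rfl⟩ | ⟨ha, l, hl, rfl, rfl⟩)
      · exact Or.inl ⟨(hunit a).2 ha, rfl⟩
      · refine Or.inr ⟨fun h => ha ((hunit _).1 h), l.map θ, fun p hp => ?_,
          (map_list_prod θ l).symm, by simp⟩
        obtain ⟨q, hq, rfl⟩ := List.mem_map.1 hp
        exact hatom q (hl q hq)
    · rintro (⟨ha, rfl⟩ | ⟨ha, l, hl, hla, rfl⟩)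
      · exact Or.inl ⟨(hunit a).1 ha, rfl⟩
      · have hl0 : 0 < l.length := by
          rw [List.length_pos_iff]
          rintro rfl
          exact ha (by rw [← hla]; simp)
        obtain ⟨w, τ, hw, haw, -⟩ := hlift a l.length l.get hl0 (fun i => hl _ (List.get_mem _ _))
          (by rw [List.ofFn_get]; exact hla.symm)
        refine Or.inr ⟨fun h => ha ((hunit a).2 h), List.ofFn w, fun p hp => ?_, haw.symm,
          by simp⟩
        obtain ⟨i, rfl⟩ := (List.mem_ofFn' w p).1 hp
        exact hw i
  ext L
  constructor
  · rintro ⟨a, rfl⟩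
    exact ⟨θ a, (hL a).symm⟩
  · rintro ⟨b, rfl⟩
    obtain ⟨e, f, a, rfl⟩ := hsurj b
    refine ⟨a, ?_⟩
    simp only [hone, one_mul, mul_one]
    exact hL a

end ZeroSum


/-! ### Almost periodic sets of integers: sumsets and AAMPs. -/

section AlmostPeriodic

/-- A nonempty bounded set of integers that agrees, up to distance `M` from its extremal elements,
with a `d`-periodic set containing it. -/
def IsAlmostPeriodic (d M : ℕ) (A : Set ℤ) : Prop :=
  ∃ (s t : ℤ) (R : Set ℤ), IsLeast A s ∧ IsGreatest A t ∧ (∀ x ∈ R, ∀ j : ℤ, x + d * j ∈ R) ∧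
    A ⊆ R ∧ ∀ x ∈ R, s + M ≤ x → x ≤ t - M → x ∈ A

variable {d M : ℕ} {A B : Set ℤ}

theorem IsAlmostPeriodic.mono {d' M' : ℕ} (h : IsAlmostPeriodic d M A) (hd : d ∣ d')
    (hM : M ≤ M') : IsAlmostPeriodic d' M' A := by
  obtain ⟨s, t, R, hs, ht, hR, hAR, hRA⟩ := h
  obtain ⟨c, rfl⟩ := hd
  refine ⟨s, t, R, hs, ht, fun x hx j => ?_, hAR, fun x hx h1 h2 => hRA x hx ?_ ?_⟩
  · have := hR x hx (c * j)
    rwa [← mul_assoc, ← Nat.cast_mul] at this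
  · omega
  · omega

theorem isAlmostPeriodic_of_diam_lt {s t : ℤ} (hs : IsLeast A s) (ht : IsGreatest A t)
    (h : t - s < 2 * M) : IsAlmostPeriodic d M A :=
  ⟨s, t, Set.univ, hs, ht, fun _ _ _ => trivial, fun _ _ => trivial, fun x _ h1 h2 => by omega⟩

/-- For short `A` the pattern is `A + R`. A point at depth `3 * M + 2 * d` in the sumset has its
second summand at depth at least `M`, since `a` varies by at most `2 * M + 2 * d`. -/
theorem isAlmostPeriodic_add_of_diam_le {s t : ℤ} (hs : IsLeast A s) (ht : IsGreatest A t)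
    (hst : t - s ≤ 2 * M + 2 * d) (hB : IsAlmostPeriodic d M B) :
    IsAlmostPeriodic d (3 * M + 2 * d) (A + B) := by
  obtain ⟨s', t', R, hs', ht', hR, hBR, hRB⟩ := hB
  refine ⟨s + s', t + t', A + R, ⟨Set.add_mem_add hs.1 hs'.1, ?_⟩,
    ⟨Set.add_mem_add ht.1 ht'.1, ?_⟩, ?_, Set.add_subset_add_left hBR, ?_⟩
  · rintro _ ⟨a, ha, b, hb, rfl⟩
    exact add_le_add (hs.2 ha) (hs'.2 hb)
  · rintro _ ⟨a, ha, b, hb, rfl⟩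
    exact add_le_add (ht.2 ha) (ht'.2 hb)
  · rintro _ ⟨a, ha, r, hr, rfl⟩ j
    exact ⟨a, ha, r + d * j, hR r hr j, by simp only; ring⟩
  · rintro _ ⟨a, ha, r, hr, rfl⟩ h1 h2
    have h3 := hs.2 ha
    have h4 := ht.2 ha
    simp only at h1 h2
    push_cast at h1 h2
    exact ⟨a, ha, r, hRB r hr (by omega) (by omega), rfl⟩

theorem IsAlmostPeriodic.add (hd : 0 < d) (hA : IsAlmostPeriodic d M A)
    (hB : IsAlmostPeriodic d M B) : IsAlmostPeriodic d (3 * M + 2 * d) (A + B) := by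
  obtain ⟨s, t, R, hs, ht, hR, hAR, hRA⟩ := id hA
  by_cases hst : t - s ≤ 2 * M + 2 * d
  · exact isAlmostPeriodic_add_of_diam_le hs ht hst hB
  obtain ⟨s', t', R', hs', ht', hR', hBR', hRB'⟩ := hB
  by_cases hst' : t' - s' ≤ 2 * M + 2 * d
  · rw [add_comm A B]
    exact isAlmostPeriodic_add_of_diam_le hs' ht' hst' hA
  refine ⟨s + s', t + t', R + R', ⟨Set.add_mem_add hs.1 hs'.1, ?_⟩,
    ⟨Set.add_mem_add ht.1 ht'.1, ?_⟩, ?_, Set.add_subset_add hAR hBR', ?_⟩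
  · rintro _ ⟨a, ha, b, hb, rfl⟩
    exact add_le_add (hs.2 ha) (hs'.2 hb)
  · rintro _ ⟨a, ha, b, hb, rfl⟩
    exact add_le_add (ht.2 ha) (ht'.2 hb)
  · rintro _ ⟨a, ha, r, hr, rfl⟩ j
    exact ⟨a, ha, r + d * j, hR' r hr j, by simp only; ring⟩
  · rintro _ ⟨r, hr, r', hr', rfl⟩ h1 h2
    simp only at h1 h2
    push_cast at h1 h2
    -- Moving `d * k` from `r'` to `r` keeps the sum. The least multiple meeting both lower bounds
    -- brings both summands into their middle ranges, because both sets are long and the sum lies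
    -- deep inside.
    obtain ⟨k, hk1, hk2⟩ : ∃ k : ℤ, max (s + M - r) (r' - t' + M) ≤ d * k ∧
        d * k < max (s + M - r) (r' - t' + M) + d := by
      generalize max (s + M - r) (r' - t' + M) = q
      have h3 := Int.emod_add_mul_ediv (-q) d
      have h4 := Int.emod_nonneg (-q) (b := d) (by omega)
      have h5 := Int.emod_lt_of_pos (-q) (b := d) (by omega)
      exact ⟨-((-q) / d), by rw [mul_neg]; omega, by rw [mul_neg]; omega⟩
    refine ⟨r + d * k, hRA _ (hR r hr k) ?_ ?_, r' + d * (-k), hRB' _ (hR' r' hr' (-k)) ?_ ?_,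
      by simp only; ring⟩ <;> rw [max_def] at hk1 hk2 <;> try rw [mul_neg]
    all_goals
      generalize (d : ℤ) * k = e at *
      split_ifs at hk1 hk2 <;> omega

theorem exists_isAlmostPeriodic_sum {ι : Type*} (hd : 0 < d) (M : ℕ) (S : Finset ι) :
    ∃ M' : ℕ, ∀ A : ι → Set ℤ, (∀ i ∈ S, IsAlmostPeriodic d M (A i)) →
      IsAlmostPeriodic d M' (∑ i ∈ S, A i) := by
  classical
  induction S using Finset.induction_on with
  | empty =>
    refine ⟨1, fun A _ => isAlmostPeriodic_of_diam_lt (s := 0) (t := 0) ?_ ?_ (by simp)⟩ <;>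
    simp only [Finset.sum_empty, ← Set.singleton_zero, isLeast_singleton, isGreatest_singleton]
  | insert i S hi ih =>
    obtain ⟨M', hM'⟩ := ih
    refine ⟨3 * (M + M') + 2 * d, fun A hA => ?_⟩
    rw [Finset.sum_insert hi]
    exact ((hA i (Finset.mem_insert_self _ _)).mono dvd_rfl (Nat.le_add_right _ _)).add hd
      ((hM' A fun j hj => hA j (Finset.mem_insert_of_mem hj)).mono dvd_rfl (Nat.le_add_left _ _))

theorem IsAlmostPeriodic.exists_isAAMP (hd : 0 < d) (h : IsAlmostPeriodic d M A) :
    ∃ P, IsAAMP A d P (2 * d * M) := by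
  obtain ⟨s, t, R, hs, ht, hR, hAR, hRA⟩ := h
  have hd' : (0 : ℤ) < d := by exact_mod_cast hd
  have hmod : ∀ x : ℤ, x % d ∈ Set.Icc 0 (d : ℤ) := fun x =>
    ⟨Int.emod_nonneg _ hd'.ne', (Int.emod_lt_of_pos x hd').le⟩
  by_cases hst : t - s ≤ 2 * d * M
  · refine ⟨Set.Icc 0 d, hd, ?_, subset_rfl, s, 0, ∅, {0}, {x | s + x ∈ A ∧ x ≠ 0},
      ?_, ?_, Set.finite_singleton 0, isLeast_singleton, isGreatest_singleton, ?_, by simp, ?_⟩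
    · rintro x (rfl | rfl) <;> simp
    · ext x
      simp only [Set.empty_union, Set.mem_image, Set.mem_union, Set.mem_singleton_iff,
        Set.mem_ofPred_eq]
      constructor
      · intro hx
        refine ⟨x - s, ?_, by ring⟩
        by_cases h0 : x - s = 0
        · exact Or.inl h0
        · exact Or.inr ⟨by simpa using hx, h0⟩
      · rintro ⟨y, rfl | ⟨hy, -⟩, rfl⟩
        · simpa using hs.1
        · exact hy
    · exact fun x _ => ⟨x % d, hmod x, x / d, (Int.emod_add_mul_ediv x d).symm⟩
    · ext x
      simp only [Set.mem_singleton_iff, Set.Icc_self, Set.mem_inter_iff, Set.mem_ofPred_eq]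
      refine ⟨?_, fun h => h.2⟩
      rintro rfl
      exact ⟨⟨0, by simp, 0, by simp⟩, rfl⟩
    · rintro x ⟨hx, h0⟩
      have h1 := hs.2 hx
      have h2 := ht.2 hx
      push_cast
      exact ⟨by omega, by omega⟩
  · have hdM : (M : ℤ) ≤ d * M := le_mul_of_one_le_left (by positivity) (by omega)
    have e : (2 * d * M : ℤ) = 2 * (d * M) := by ring
    rw [e] at hst
    -- Shifting the extremal elements inward by a multiple of `d` that is at least `M` keeps them in
    -- `A`; they become the ends of the central part.
    have hy : s + d * M ∈ A := hRA _ (hR s (hAR hs.1) M) (by omega) (by omega)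
    have hz : t - d * M ∈ A := by
      refine hRA _ ?_ (by omega) (by omega)
      have := hR t (hAR ht.1) (-M)
      rwa [mul_neg, ← sub_eq_add_neg] at this
    have hpat : ∀ x, s + d * M + x ∈ R ↔
        ∃ p ∈ {p | s + d * M + p ∈ R ∧ p ∈ Set.Icc 0 (d : ℤ)}, ∃ k : ℤ, x = p + d * k := by
      intro x
      constructor
      · intro hx
        refine ⟨x % d, ⟨?_, hmod x⟩, x / d, (Int.emod_add_mul_ediv x d).symm⟩
        have h1 := hR _ hx (-(x / d))
        have h2 := Int.emod_add_mul_ediv x d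
        rw [mul_neg] at h1
        convert h1 using 1
        linarith
      · rintro ⟨p, ⟨hp, -⟩, k, rfl⟩
        have := hR _ hp k
        rwa [add_assoc] at this
    have hLc : {x | s + d * M + x ∈ A ∧ x ∈ Set.Icc 0 (t - s - 2 * (d * M))} =
        {x | ∃ p ∈ {p | s + d * M + p ∈ R ∧ p ∈ Set.Icc 0 (d : ℤ)}, ∃ k : ℤ, x = p + d * k} ∩
          Set.Icc 0 (t - s - 2 * (d * M)) := by
      ext x
      refine and_congr_left fun hx => Iff.trans ?_ (hpat x)
      exact ⟨fun h => hAR h, fun h => hRA _ h (by have := hx.1; omega) (by have := hx.2; omega)⟩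
    refine ⟨{p | s + d * M + p ∈ R ∧ p ∈ Set.Icc 0 (d : ℤ)}, hd, ?_, fun p hp => hp.2,
      s + d * M, t - s - 2 * (d * M), {x | s + d * M + x ∈ A ∧ x < 0},
      {x | s + d * M + x ∈ A ∧ x ∈ Set.Icc 0 (t - s - 2 * (d * M))},
      {x | s + d * M + x ∈ A ∧ t - s - 2 * (d * M) < x}, ?_, ?_, ?_, ?_, ?_, hLc, ?_, ?_⟩
    · rintro x (rfl | rfl)
      · exact ⟨by simpa using hAR hy, by simp⟩
      · exact ⟨by simpa using hR _ (hAR hy) 1, by simp⟩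
    · ext x
      constructor
      · intro hx
        refine ⟨x - (s + d * M), ?_, by ring⟩
        have hx' : s + d * M + (x - (s + d * M)) ∈ A := by simpa using hx
        rcases lt_or_ge (x - (s + d * M)) 0 with h | h
        · exact Or.inl (Or.inl ⟨hx', h⟩)
        · rcases le_or_gt (x - (s + d * M)) (t - s - 2 * (d * M)) with h' | h'
          · exact Or.inl (Or.inr ⟨hx', h, h'⟩)
          · exact Or.inr ⟨hx', h'⟩
      · rintro ⟨y, (⟨hy, -⟩ | ⟨hy, -⟩) | ⟨hy, -⟩, rfl⟩ <;> exact hy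
    · rintro x ((⟨hx, -⟩ | ⟨hx, -⟩) | ⟨hx, -⟩) <;> exact (hpat x).1 (hAR hx)
    · exact (Set.finite_Icc _ _).subset fun x hx => hx.2
    · exact ⟨⟨by simpa using hy, by simp; omega⟩, fun x hx => hx.2.1⟩
    · refine ⟨⟨?_, by simp; omega⟩, fun x hx => hx.2.2⟩
      convert hz using 1
      ring
    · rintro x ⟨hx, h0⟩
      have := hs.2 hx
      push_cast
      rw [e]
      exact ⟨by omega, by omega⟩
    · rintro x ⟨hx, h0⟩
      have := ht.2 hx
      push_cast
      rw [e]
      exact ⟨by omega, by omega⟩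

end AlmostPeriodic

/-! ### Locally tame strongly primary monoids. -/

section Tame

variable {H : Type u} [CancelCommMonoid H]

theorem irreducible_associatesMk_iff {a : H} : Irreducible (Associates.mk a) ↔ Irreducible a := by
  simp only [irreducible_iff, Associates.isUnit_mk, Associates.forall_associated,
    Associates.mk_mul_mk, Associates.mk_eq_mk_iff_associated]
  refine and_congr_right fun _ => ⟨fun h x y hxy => h x y (hxy ▸ Associated.refl _), ?_⟩
  rintro h x y ⟨e, he⟩
  have := @h (x * ↑e⁻¹) y ?_
  · rwa [Units.isUnit_mul_units] at this
  · rw [mul_right_comm, Units.eq_mul_inv_iff_mul_eq, he]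

theorem mem_setOfLengths_iff_factorizations {a : H} {k : ℕ} :
    k ∈ setOfLengths a ↔ ∃ z ∈ factorizations a, z.card = k := by
  rw [mem_setOfLengths_iff]
  constructor
  · rintro ⟨s, hs, hsa, rfl⟩
    refine ⟨s.map Associates.mk, ⟨fun p hp => ?_, ?_⟩, by simp⟩
    · obtain ⟨q, hq, rfl⟩ := Multiset.mem_map.1 hp
      exact irreducible_associatesMk_iff.2 (hs q hq)
    · rw [Associates.prod_mk, Associates.mk_eq_mk_iff_associated]
      exact hsa
  · rintro ⟨z, ⟨hz, hza⟩, rfl⟩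
    obtain ⟨s, rfl⟩ := Multiset.map_surjective_of_surjective Associates.mk_surjective z
    refine ⟨s, fun p hp => irreducible_associatesMk_iff.1 (hz _ (Multiset.mem_map_of_mem _ hp)), ?_,
      by simp⟩
    rwa [Associates.prod_mk, Associates.mk_eq_mk_iff_associated] at hza

theorem mem_factorizations_mul_cons {u a : H} {z : Multiset (Associates H)} (hu : Irreducible u) :
    Associates.mk u ::ₘ z ∈ factorizations (u * a) ↔ z ∈ factorizations a := by
  obtain ⟨s, rfl⟩ := Multiset.map_surjective_of_surjective Associates.mk_surjective z
  simp only [factorizations, Set.mem_ofPred_eq, Multiset.mem_cons, forall_eq_or_imp,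
    irreducible_associatesMk_iff, hu, true_and, Multiset.prod_cons, Associates.prod_mk,
    Associates.mk_mul_mk, Associates.mk_eq_mk_iff_associated]
  refine and_congr_right fun _ => ⟨?_, fun h => h.mul_left u⟩
  rintro ⟨e, he⟩
  exact ⟨e, mul_left_cancel (by rwa [mul_assoc] at he)⟩

/-- Tameness moves a factorization of `u * a` to a nearby one containing `u`; deleting `u` leaves a
factorization of `a`. -/
theorem IsLocallyTame.exists_bound_of_irreducible (h : IsLocallyTame H)
    (hne : ∀ a : H, (setOfLengths a).Nonempty) {u : H} (hu : Irreducible u) :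
    ∃ N : ℕ, ∀ a : H, ∀ k ∈ setOfLengths (u * a),
      ∃ l ∈ setOfLengths a, k ≤ l + 1 + N ∧ l + 1 ≤ k + N := by
  classical
  obtain ⟨N, hN⟩ := h (Associates.mk u) (irreducible_associatesMk_iff.2 hu)
  refine ⟨N, fun a k hk => ?_⟩
  obtain ⟨z, hz, rfl⟩ := mem_setOfLengths_iff_factorizations.1 hk
  obtain ⟨m, hm⟩ := hne a
  obtain ⟨x, hx, -⟩ := mem_setOfLengths_iff_factorizations.1 hm
  obtain ⟨z', hz', huz', hd⟩ := hN (u * a)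
    ⟨_, (mem_factorizations_mul_cons hu).2 hx, Multiset.mem_cons_self _ _⟩ z hz
  obtain ⟨t, rfl⟩ := Multiset.exists_cons_of_mem huz'
  refine ⟨t.card, mem_setOfLengths_iff_factorizations.2
    ⟨t, (mem_factorizations_mul_cons hu).1 hz', rfl⟩, ?_⟩
  have key : ∀ y y' : Multiset (Associates H), y.card ≤ y'.card + (y - y').card := by
    intro y y'
    rw [← Multiset.card_add]
    exact Multiset.card_le_card (by rw [add_comm]; exact le_tsub_add)
  have h1 := key z (Associates.mk u ::ₘ t)
  have h2 := key (Associates.mk u ::ₘ t) z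
  unfold factorizationDist at hd
  rw [Multiset.card_cons] at h1 h2
  have h3 := (le_max_left _ _).trans hd
  have h4 := (le_max_right _ _).trans hd
  constructor
  · refine h1.trans (Nat.add_le_add_left ?_ _)
    convert h3
  · refine h2.trans (Nat.add_le_add_left ?_ _)
    convert h4

theorem IsLocallyTame.exists_bound (h : IsLocallyTame H)
    (hne : ∀ a : H, (setOfLengths a).Nonempty) (e : H) :
    ∃ N : ℕ, ∀ a : H, ∀ k ∈ setOfLengths (e * a), ∃ l ∈ setOfLengths a, k ≤ l + N ∧ l ≤ k + N := by
  obtain ⟨m, hm⟩ := hne e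
  obtain ⟨s, hs, hse, -⟩ := mem_setOfLengths_iff.1 hm
  simp only [← fun a => setOfLengths_congr (hse.mul_right a)]
  clear hse hm
  induction s using Multiset.induction with
  | empty => exact ⟨0, fun a k hk => ⟨k, by simpa using hk, by simp⟩⟩
  | cons p s ih =>
    obtain ⟨N₁, h₁⟩ := h.exists_bound_of_irreducible hne (hs p (Multiset.mem_cons_self _ _))
    obtain ⟨N₂, h₂⟩ := ih fun q hq => hs q (Multiset.mem_cons_of_mem hq)
    refine ⟨N₁ + N₂ + 1, fun a k hk => ?_⟩
    rw [Multiset.prod_cons, mul_assoc] at hk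
    obtain ⟨l, hl, h3, h4⟩ := h₁ _ k hk
    obtain ⟨l', hl', h5, h6⟩ := h₂ _ l hl
    exact ⟨l', hl', by omega, by omega⟩

theorem IsStronglyPrimary.exists_irreducible (h : IsStronglyPrimary H) :
    ∃ u : H, Irreducible u := by
  obtain ⟨a, ha⟩ := h.1
  obtain ⟨k, ⟨ha', -⟩ | ⟨-, l, hl, hla, -⟩⟩ := h.setOfLengths_nonempty a
  · exact absurd ha' ha
  · cases l with
    | nil => exact absurd (hla ▸ isUnit_one) ha
    | cons p l => exact ⟨p, hl p (List.mem_cons_self ..)⟩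

/-- The gaps in the sets of lengths of a locally tame strongly primary monoid are bounded. -/
theorem IsStronglyPrimary.exists_gap_bound (h : IsStronglyPrimary H) (ht : IsLocallyTame H) :
    ∃ C : ℕ, ∀ a : H, ∀ k ∈ setOfLengths a, ∀ l ∈ setOfLengths a, ∀ x : ℕ, k ≤ x → x < l →
      ∃ y ∈ setOfLengths a, x < y ∧ y ≤ x + C := by
  obtain ⟨u, hu⟩ := h.exists_irreducible
  obtain ⟨n, hn⟩ := h.exists_dvd_of_mem_setOfLengths u
  obtain ⟨N, hN⟩ := ht.exists_bound_of_irreducible h.setOfLengths_nonempty hu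
  refine ⟨n + N, fun a => ?_⟩
  obtain ⟨b, hb⟩ := h.exists_setOfLengths_le a
  -- If `l` is large, then `a = u * a'` and `setOfLengths a' + 1` lies in `setOfLengths a`, with
  -- elements within `N` of `k` and `l`. Between these the gap bound comes from `a'`, whose lengths
  -- are smaller.
  induction b generalizing a with
  | zero =>
    intro k _ l hl x _ hxl
    have := hb l hl
    omega
  | succ b ih =>
    intro k hk l hl x hkx hxl
    rcases lt_or_ge l n with hln | hln
    · exact ⟨l, hl, hxl, by omega⟩
    obtain ⟨a', rfl⟩ := hn a l hl hln
    have hmem : ∀ m ∈ setOfLengths a', m + 1 ∈ setOfLengths (u * a') := fun m hm => by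
      rw [add_comm]
      exact add_mem_setOfLengths (one_mem_setOfLengths hu) hm
    obtain ⟨k', hk', h1, h2⟩ := hN a' k hk
    obtain ⟨l', hl', h3, h4⟩ := hN a' l hl
    rcases lt_or_ge x (k' + 1) with hx | hx
    · exact ⟨k' + 1, hmem k' hk', hx, by omega⟩
    rcases le_or_gt (l' + 1) x with hx' | hx'
    · exact ⟨l, hl, hxl, by omega⟩
    obtain ⟨y, hy, h5, h6⟩ := ih a' (fun m hm => by have := hb _ (hmem m hm); omega) k' hk' l' hl'
      (x - 1) (by omega) (by omega)
    exact ⟨y + 1, hmem y hy, by omega, by omega⟩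

/-- The differences of lengths are the multiples of a single attained difference. -/
theorem exists_generating_difference (hne : ∀ a : H, (setOfLengths a).Nonempty)
    (hnhf : ∃ c : H, ∃ k ∈ setOfLengths c, ∃ l ∈ setOfLengths c, k < l) :
    ∃ d : ℕ, 0 < d ∧ (∃ c : H, ∃ k ∈ setOfLengths c, k + d ∈ setOfLengths c) ∧
      ∀ a : H, ∀ k ∈ setOfLengths a, ∀ l ∈ setOfLengths a, (d : ℤ) ∣ (l : ℤ) - k := by
  -- Lengths add under products, so the differences of lengths over all of `H` already form a group,
  -- and its generator is itself a difference.
  let Γ : AddSubgroup ℤ :=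
    { carrier := {x | ∃ c : H, ∃ k ∈ setOfLengths c, ∃ l ∈ setOfLengths c, (l : ℤ) - k = x}
      zero_mem' := by
        obtain ⟨k, hk⟩ := hne 1
        exact ⟨1, k, hk, k, hk, sub_self _⟩
      add_mem' := by
        rintro _ _ ⟨c, k, hk, l, hl, rfl⟩ ⟨c', k', hk', l', hl', rfl⟩
        exact ⟨c * c', k + k', add_mem_setOfLengths hk hk', l + l', add_mem_setOfLengths hl hl',
          by push_cast; ring⟩
      neg_mem' := by
        rintro _ ⟨c, k, hk, l, hl, rfl⟩
        exact ⟨c, l, hl, k, hk, by ring⟩ }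
  obtain ⟨g, hg⟩ := Int.subgroup_cyclic Γ
  have hmem : ∀ x, x ∈ Γ ↔ (g.natAbs : ℤ) ∣ x := fun x => by
    rw [hg, ← AddSubgroup.zmultiples_eq_closure, Int.mem_zmultiples_iff, Int.natAbs_dvd]
  refine ⟨g.natAbs, ?_, ?_, fun a k hk l hl => (hmem _).1 ⟨a, k, hk, l, hl, rfl⟩⟩
  · obtain ⟨c, k, hk, l, hl, hkl⟩ := hnhf
    rw [Nat.pos_iff_ne_zero]
    intro h0
    have := (hmem _).1 ⟨c, k, hk, l, hl, rfl⟩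
    rw [h0, Nat.cast_zero, zero_dvd_iff] at this
    omega
  · obtain ⟨c, k, hk, l, hl, hkl⟩ := (hmem _).2 (dvd_refl _)
    refine ⟨c, k, hk, ?_⟩
    have : l = k + g.natAbs := by omega
    exact this ▸ hl

theorem add_mul_mem_setOfLengths_pow {c : H} {k d : ℕ} (hk : k ∈ setOfLengths c)
    (hkd : k + d ∈ setOfLengths c) {i j : ℕ} (hij : i ≤ j) :
    j * k + i * d ∈ setOfLengths (c ^ j) := by
  have := add_mem_setOfLengths (mul_mem_setOfLengths_pow hkd i)
    (mul_mem_setOfLengths_pow hk (j - i))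
  rw [← pow_add, Nat.add_sub_cancel' hij] at this
  convert this using 1
  obtain ⟨r, rfl⟩ := Nat.exists_eq_add_of_le hij
  rw [Nat.add_sub_cancel_left]
  ring

theorem exists_isLeast_isGreatest_image {A : Set ℕ} (hA : A.Nonempty) {n : ℕ}
    (hn : ∀ k ∈ A, k ≤ n) :
    ∃ s ∈ A, ∃ t ∈ A, IsLeast ((fun k : ℕ => (k : ℤ)) '' A) s ∧
      IsGreatest ((fun k : ℕ => (k : ℤ)) '' A) t := by
  have hfin : A.Finite := (Set.finite_Iic n).subset hn
  obtain ⟨s, hs⟩ := hfin.exists_minimal hA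
  obtain ⟨t, ht⟩ := hfin.exists_maximal hA
  refine ⟨s, hs.1, t, ht.1, ⟨⟨s, hs.1, rfl⟩, ?_⟩, ⟨⟨t, ht.1, rfl⟩, ?_⟩⟩
  · rintro _ ⟨k, hk, rfl⟩
    exact Nat.cast_le.2 ((le_total s k).elim id (hs.2 hk))
  · rintro _ ⟨k, hk, rfl⟩
    exact Nat.cast_le.2 ((le_total k t).elim id (ht.2 hk))

/-- The sets of lengths of a locally tame strongly primary monoid are almost arithmetical
progressions with a common difference and a common bound. -/
theorem IsStronglyPrimary.exists_isAlmostPeriodic (h : IsStronglyPrimary H) (ht : IsLocallyTame H)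
    (hnhf : ¬ IsHalfFactorial H) :
    ∃ d M : ℕ, 0 < d ∧ ∀ a : H,
      IsAlmostPeriodic d M ((fun k : ℕ => (k : ℤ)) '' setOfLengths a) := by
  obtain ⟨d, hd, ⟨c, k, hk, hkd⟩, hdvd⟩ := exists_generating_difference h.setOfLengths_nonempty
    (h.exists_lt_of_not_isHalfFactorial hnhf)
  obtain ⟨C, hC⟩ := h.exists_gap_bound ht
  obtain ⟨n, hn⟩ := h.exists_dvd_of_mem_setOfLengths (c ^ C)
  obtain ⟨N, hN⟩ := ht.exists_bound h.setOfLengths_nonempty (c ^ C)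
  -- The summand `n` covers elements too short to be divisible by `c ^ C`; `N` is the loss at the
  -- ends in passing to `a'`; the rest leaves room for a length of `c ^ C`.
  refine ⟨d, n + (N + C * k + C * d + 1), hd, fun a => ?_⟩
  obtain ⟨b, hb⟩ := h.exists_setOfLengths_le a
  obtain ⟨s, hs, t, ht, hsl, htg⟩ :=
    exists_isLeast_isGreatest_image (h.setOfLengths_nonempty a) hb
  rcases lt_or_ge t n with htn | htn
  · exact isAlmostPeriodic_of_diam_lt hsl htg (by zify at htn; push_cast; nlinarith)
  obtain ⟨a', rfl⟩ := hn a t ht htn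
  obtain ⟨s', hs', -, h2⟩ := hN a' s hs
  obtain ⟨t', ht', h3, -⟩ := hN a' t ht
  refine ⟨s, t, {x | (d : ℤ) ∣ x - s}, hsl, htg, ?_, ?_, ?_⟩
  · intro x hx j
    rw [Set.mem_ofPred_eq] at *
    have := dvd_add hx (dvd_mul_right (d : ℤ) j)
    rwa [sub_add_eq_add_sub] at this
  · rintro _ ⟨l, hl, rfl⟩
    exact hdvd _ s hs l hl
  · intro x hx h4 h5
    have hCd : C ≤ C * d := Nat.le_mul_of_pos_right C hd
    push_cast at h4 h5
    have hx0 : 0 ≤ x := by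
      have h0 : (0 : ℤ) ≤ C * k := by positivity
      have h0' : (0 : ℤ) ≤ C * d := by positivity
      omega
    lift x to ℕ using hx0
    have h4' : s + (n + (N + C * k + C * d + 1)) ≤ x := by exact_mod_cast h4
    have h5' : x + (n + (N + C * k + C * d + 1)) ≤ t := by
      zify
      linarith
    generalize hCk : C * k = Ck at *
    generalize hCd' : C * d = Cd at *
    -- Since `C ≤ C * d`, the remainder `x - Ck - y` lies between 0 and `C * d`. It is divisible by
    -- `d`, so `c ^ C` has the length `x - y`.
    obtain ⟨y, hy, h6, h7⟩ := hC a' s' hs' t' ht' (x - Ck - Cd - 1) (by omega) (by omega)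
    have hCkmem : Ck ∈ setOfLengths (c ^ C) := hCk ▸ mul_mem_setOfLengths_pow hk C
    have hdv : (d : ℤ) ∣ ((x - Ck - y : ℕ) : ℤ) := by
      have h8 := hdvd _ s hs _ (add_mem_setOfLengths hCkmem hy)
      have h9 := dvd_sub hx h8
      have h10 : ((x - Ck - y : ℕ) : ℤ) = x - s - ((Ck + y : ℕ) - s) := by omega
      rwa [h10]
    obtain ⟨i, hi⟩ := Int.natCast_dvd_natCast.1 hdv
    have hiC : i ≤ C := by
      refine Nat.le_of_mul_le_mul_left (c := d) ?_ hd
      rw [← hi, mul_comm d C, hCd']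
      omega
    refine ⟨x, ?_, rfl⟩
    have := add_mem_setOfLengths (add_mul_mem_setOfLengths_pow hk hkd hiC) hy
    rw [hCk, mul_comm i d, ← hi] at this
    convert this using 1
    omega

end Tame


/-! ### The three assertions for direct products. -/

section DirectProduct

variable {ι : Type*} [Fintype ι] {D : ι → Type u} [∀ i, CancelCommMonoid (D i)]

theorem translate_notMem_systemOfLengths_pi (hprim : ∀ i, IsStronglyPrimary (D i))
    (hnhf : ∀ i, ¬ IsHalfFactorial (D i)) {L : Finset ℕ} (hL : L.Nonempty) :
    ∃ yL : ℕ, ∀ y : ℕ, yL ≤ y →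
      (fun l => y + l) '' (L : Set ℕ) ∉ systemOfLengths (∀ i, D i) := by
  classical
  -- The spread `L.sup id + 1` exceeds the diameter of every translate of `L`.
  choose N hN using fun i =>
    (hprim i).exists_add_le_of_not_isHalfFactorial (hnhf i) (L.sup id + 1)
  refine ⟨∑ i, N i + 1, fun y hy => ?_⟩
  rintro ⟨b, hb⟩
  replace hb : setOfLengths b = (fun l => y + l) '' (L : Set ℕ) := hb
  obtain ⟨l₀, hl₀⟩ := hL
  have hmem : y + l₀ ∈ setOfLengths b := hb ▸ ⟨l₀, hl₀, rfl⟩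
  obtain ⟨f, hf, hsum⟩ := mem_setOfLengths_pi_iff.1 hmem
  obtain ⟨i, -, hi⟩ := Finset.exists_lt_of_sum_lt (s := Finset.univ) (f := N) (g := f) (by omega)
  obtain ⟨k, hk, l, hl, hkl⟩ := hN i (b i) (f i) (hf i) hi.le
  have hupd : ∀ m ∈ setOfLengths (b i), m + ∑ j ∈ Finset.univ.erase i, f j ∈ setOfLengths b := by
    intro m hm
    refine mem_setOfLengths_pi_iff.2 ⟨Function.update f i m, fun j => ?_, ?_⟩
    · by_cases hj : j = i
      · subst hj
        simpa using hm
      · simpa [hj] using hf j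
    · rw [← Finset.add_sum_erase _ _ (Finset.mem_univ i), Function.update_self]
      congr 1
      exact Finset.sum_congr rfl fun j hj => Function.update_of_ne (Finset.ne_of_mem_erase hj) _ _
  have h1 := hupd k hk
  have h2 := hupd l hl
  rw [hb] at h1 h2
  obtain ⟨p, -, hp⟩ := h1
  obtain ⟨q, hq, hq'⟩ := h2
  have h3 : q ≤ L.sup id := Finset.le_sup (f := id) hq
  simp only at hp hq'
  omega

theorem systemOfLengths_pi_ne_zeroSumMonoid [Nonempty ι] (hprim : ∀ i, IsStronglyPrimary (D i))
    (hnhf : ∀ i, ¬ IsHalfFactorial (D i)) {G : Type v} [AddCommGroup G] (G₀ : Set G) :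
    systemOfLengths (∀ i, D i) ≠ systemOfLengths (zeroSumMonoid G₀) := by
  classical
  intro heq
  obtain ⟨y, hy⟩ := translate_notMem_systemOfLengths_pi hprim hnhf (Finset.singleton_nonempty 1)
  refine hy y le_rfl ?_
  rw [heq, Finset.coe_singleton, Set.image_singleton]
  refine singleton_mem_systemOfLengths_zeroSumMonoid ?_ _
  by_contra! hB
  obtain ⟨i⟩ := ‹Nonempty ι›
  obtain ⟨a, ha⟩ := (hprim i).1
  have hmem : setOfLengths (Pi.mulSingle i a : ∀ i, D i) ∈ systemOfLengths (∀ i, D i) := ⟨_, rfl⟩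
  rw [heq] at hmem
  obtain ⟨B, hBL⟩ := hmem
  refine ha (isUnit_mulSingle_iff.1 (zero_mem_setOfLengths_iff.1 (hBL ▸ ?_)))
  exact zero_mem_setOfLengths_iff.2 (hB B ▸ isUnit_one)

theorem satisfiesStructureTheorem_pi (hprim : ∀ i, IsStronglyPrimary (D i))
    (hnhf : ∀ i, ¬ IsHalfFactorial (D i)) (htame : ∀ i, IsLocallyTame (D i)) :
    SatisfiesStructureTheorem (∀ i, D i) := by
  classical
  choose d M hd hAP using fun i => (hprim i).exists_isAlmostPeriodic (htame i) (hnhf i)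
  have hdpos : 0 < ∏ i, d i := Finset.prod_pos fun i _ => hd i
  -- The product of the `d i` and the sum of the `M i` serve as common parameters for all
  -- components.
  obtain ⟨M', hM'⟩ := exists_isAlmostPeriodic_sum hdpos (∑ i, M i) (Finset.univ : Finset ι)
  refine ⟨isAtomicMonoid_iff_setOfLengths_nonempty.2 fun a => ?_,
    2 * (∏ i, d i) * M', {∏ i, d i}, Finset.singleton_nonempty _, by simpa using hd, ?_⟩
  · choose f hf using fun i => (hprim i).setOfLengths_nonempty (a i)
    exact ⟨_, mem_setOfLengths_pi_iff.2 ⟨f, hf, rfl⟩⟩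
  · rintro _ ⟨a, rfl⟩
    refine ⟨_, Finset.mem_singleton_self _, IsAlmostPeriodic.exists_isAAMP hdpos ?_⟩
    convert hM' (fun i => (fun k : ℕ => (k : ℤ)) '' setOfLengths (a i)) fun i _ =>
      (hAP i (a i)).mono (Finset.dvd_prod_of_mem d (Finset.mem_univ i))
        (Finset.single_le_sum (f := M) (fun _ _ => Nat.zero_le _) (Finset.mem_univ i)) using 1
    ext x
    rw [Set.mem_fintype_sum]
    constructor
    · rintro ⟨k, hk, rfl⟩
      obtain ⟨f, hf, rfl⟩ := mem_setOfLengths_pi_iff.1 hk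
      exact ⟨fun i => f i, fun i => ⟨f i, hf i, rfl⟩, by simp⟩
    · rintro ⟨g, hg, rfl⟩
      choose f hf hfg using fun i => hg (i := i)
      refine ⟨∑ i, f i, mem_setOfLengths_pi_iff.2 ⟨f, hf, rfl⟩, ?_⟩
      simp only [Nat.cast_sum]
      exact Finset.sum_congr rfl fun i _ => hfg i

end DirectProduct

end FactorizationTheory

theorem theorem5p6 (n : ℕ) (hn : 0 < n) (D : Fin n → Type u)
    [∀ i, CancelCommMonoid (D i)]
    (hprim : ∀ i, IsStronglyPrimary (D i))
    (hnhf : ∀ i, ¬ IsHalfFactorial (D i)) :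
    (∀ L : Finset ℕ, L.Nonempty → (∀ l ∈ L, 0 < l) →
      ∃ yL : ℕ, ∀ y : ℕ, yL ≤ y →
        (fun l => y + l) '' (L : Set ℕ) ∉ systemOfLengths (∀ i, D i)) ∧
    (∀ (G : Type v) [AddCommGroup G] (G₀ : Set G),
      systemOfLengths (∀ i, D i) ≠ systemOfLengths (zeroSumMonoid G₀)) ∧
    ¬ IsTransferKrull.{u, v} (∀ i, D i) ∧
    ((∀ i, IsLocallyTame (D i)) → SatisfiesStructureTheorem (∀ i, D i)) := by
  have : Nonempty (Fin n) := ⟨⟨0, hn⟩⟩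
  refine ⟨fun L hL _ => translate_notMem_systemOfLengths_pi hprim hnhf hL,
    fun G _ G₀ => systemOfLengths_pi_ne_zeroSumMonoid hprim hnhf G₀, ?_,
    satisfiesStructureTheorem_pi hprim hnhf⟩
  rintro ⟨G, _, G₀, θ, hθ⟩
  exact systemOfLengths_pi_ne_zeroSumMonoid hprim hnhf G₀ (systemOfLengths_eq_of_isWeakTransferHom hθ)
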